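/- Let $d\ge 0$ be an integer and let $w:\mathbb{R}^d\to\mathbb{R}$ be continuous. For $t\in\mathbb{R}$ let $K_t=\mathcal{F}^{-1}[e^{-itw}]$ be the tempered distribution on $\mathbb{R}^d$ given by $$\langle K_t,f\rangle=\int_{\mathbb{R}^d}e^{-itw(\xi)}\,(\mathcal{F}^{-1}f)(\xi)\,d\xi,\qquad (\mathcal{F}^{-1}f)(x)=(2\pi)^{-d}\int_{\mathbb{R}^d}f(\xi)e^{ix\cdot\xi}\,d\xi,$$ for Schwartz functions $f$; it is the fundamental solution at time $t$ of $i\partial_t u=Lu$, where $\widehat{Lu}=w\,\widehat u$. Then there exists $t\in\mathbb{R}\setminus\{0\}$ such that the distributional support of $K_t$ is compact if and only if $w$ is a polynomial of degree at most one, i.e. there are $a_0,a_1,\dots,a_d\in\mathbb{R}$ with $$w(\xi)=a_0+\sum_{j=1}^d a_j\xi_j\qquad\text{for all }\xi\in\mathbb{R}^d.$$ -/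

import Mathlib

open scoped SchwartzMap FourierTransform

namespace DispersiveSupport

open MeasureTheory Real

noncomputable section

/-- The dilation `ξ ↦ (2π)⁻¹ ξ` of `ℝ^d`. -/
def dilation (d : ℕ) : EuclideanSpace ℝ (Fin d) ≃L[ℝ] EuclideanSpace ℝ (Fin d) :=
  ContinuousLinearEquiv.smulLeft (Units.mk0 ((2 * π)⁻¹ : ℝ) (by positivity))

/-- The inverse Fourier transform `x ↦ (2π)⁻ᵈ ∫ f(ξ) exp(i x·ξ) dξ` on the Schwartz space, obtained
from Mathlib's (whose kernel is `exp(2πi x·ξ)`) by rescaling; the explicit integral formula is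
`schwartzFourierInv_apply`. -/
def schwartzFourierInv (d : ℕ) :
    𝓢(EuclideanSpace ℝ (Fin d), ℂ) →L[ℂ] 𝓢(EuclideanSpace ℝ (Fin d), ℂ) :=
  (((2 * π) ^ d)⁻¹ : ℂ) •
    ((SchwartzMap.compCLMOfContinuousLinearEquiv ℂ (dilation d)).comp
      (FourierTransform.fourierInvCLM ℂ 𝓢(EuclideanSpace ℝ (Fin d), ℂ)))

theorem schwartzFourierInv_apply {d : ℕ} (f : 𝓢(EuclideanSpace ℝ (Fin d), ℂ))
    (x : EuclideanSpace ℝ (Fin d)) :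
    schwartzFourierInv d f x =
      (((2 * π) ^ d)⁻¹ : ℂ) * ∫ ξ, f ξ * Complex.exp (Complex.I * (inner ℝ x ξ : ℝ)) := by
  have h : schwartzFourierInv d f x = (((2 * π) ^ d)⁻¹ : ℂ) * (𝓕⁻ f) ((2 * π)⁻¹ • x) := rfl
  rw [h, SchwartzMap.fourierInv_coe, Real.fourierInv_eq']
  congr 1
  refine integral_congr_ae (Filter.Eventually.of_forall fun ξ => ?_)
  simp only [smul_eq_mul, inner_smul_right, real_inner_comm x ξ]
  rw [mul_comm (f ξ)]
  congr 2
  have : (π : ℂ) ≠ 0 := by exact_mod_cast Real.pi_ne_zero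
  push_cast
  field_simp

/-- The inverse Fourier transform of tempered distributions, by duality:
`⟨F⁻¹ u, f⟩ = ⟨u, F⁻¹ f⟩`. -/
def temperedFourierInv {d : ℕ} (u : 𝓢'(EuclideanSpace ℝ (Fin d), ℂ)) :
    𝓢'(EuclideanSpace ℝ (Fin d), ℂ) :=
  PointwiseConvergenceCLM.precomp ℂ (schwartzFourierInv d) u

/-- The propagator symbol `ξ ↦ exp(-i t w(ξ))`. -/
def symbol {d : ℕ} (w : C(EuclideanSpace ℝ (Fin d), ℝ)) (t : ℝ)
    (ξ : EuclideanSpace ℝ (Fin d)) : ℂ :=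
  Complex.exp (-Complex.I * t * w ξ)

theorem memLp_symbol {d : ℕ} (w : C(EuclideanSpace ℝ (Fin d), ℝ)) (t : ℝ) :
    MemLp (symbol w t) ⊤ volume := by
  refine memLp_top_of_bound (C := 1) ?_ (Filter.Eventually.of_forall fun ξ => ?_)
  · refine Continuous.aestronglyMeasurable ?_
    unfold symbol
    fun_prop
  · simp [symbol, Complex.norm_exp]

/-- The bounded function `exp(-i t w)` as a tempered distribution, i.e. integration against it. -/
def symbolDistribution {d : ℕ} (w : C(EuclideanSpace ℝ (Fin d), ℝ)) (t : ℝ) :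
    𝓢'(EuclideanSpace ℝ (Fin d), ℂ) :=
  Lp.toTemperedDistribution ((memLp_symbol w t).toLp (symbol w t))

/-- The fundamental solution `K_t = F⁻¹[exp(-i t w)]`, a tempered distribution on `ℝ^d`. -/
def fundamentalSolution {d : ℕ} (w : C(EuclideanSpace ℝ (Fin d), ℝ)) (t : ℝ) :
    𝓢'(EuclideanSpace ℝ (Fin d), ℂ) :=
  temperedFourierInv (symbolDistribution w t)

theorem fundamentalSolution_apply {d : ℕ} (w : C(EuclideanSpace ℝ (Fin d), ℝ)) (t : ℝ)
    (f : 𝓢(EuclideanSpace ℝ (Fin d), ℂ)) :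
    fundamentalSolution w t f =
      ∫ ξ, Complex.exp (-Complex.I * t * w ξ) * schwartzFourierInv d f ξ := by
  have h : fundamentalSolution w t f = symbolDistribution w t (schwartzFourierInv d f) := rfl
  rw [h, symbolDistribution, Lp.toTemperedDistribution_apply]
  refine integral_congr_ae ?_
  filter_upwards [(memLp_symbol w t).coeFn_toLp] with ξ hξ
  rw [hξ, smul_eq_mul, mul_comm, symbol]

end

end DispersiveSupport

/-!
Write `u = exp(-i t w)` for the symbol and `K` for the fundamental solution, so `|u| = 1`.

Suppose that `K` has compact support. Apply `K` to truncated plane waves `χ(x / R) exp(-i x·ξ)`. As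
`R → ∞` the values tend to `u(ξ)`, while for large `R` they do not depend on `R`, since two such
waves agree near the support of `K`. Hence `u(ξ) = ∫ u(ξ + η) φ(η) dη` for one fixed Schwartz
function `φ` (`exists_isReproduced_symbol`). Such a formula can be differentiated: the derivative of
`u` in a direction `v` is `-∫ u(ξ + η) ∂ᵥφ(η) dη`, it satisfies the same formula, and its sup norm is
at most `B = ∫ |∂ᵥφ|` times that of `u` (`IsReproduced.kernelDeriv`). By iteration, the `n`-th
derivative of `u` along a line is at most `B ^ n`.

Consequently the restriction of `u` to a ray is the restriction of an entire function `F` with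
`|F(z)| ≤ exp(B |z|)` (`exists_entire_extension`). Since `|F| = 1` on the half-line,
`F(z) * conj F(conj z) = 1` everywhere, so `F` has no zeros (`ne_zero_of_norm_eq_one`), and a
zero-free entire function of exponential type is the exponential of an affine function
(`exists_eq_exp_affine`). By continuity `w` is affine on every ray (`eq_affine_of_phase`), hence
affine (`eq_affine_of_rays`).

Conversely, if `w` is affine, Fourier inversion shows that `K` is a multiple of a Dirac mass
(`dsupport_fundamentalSolution_subset`).
-/

namespace DispersiveSupport

open MeasureTheory Real Filter Topology ComplexConjugate

/-! ### Entire functions of exponential type that are unimodular on the real line -/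

/-- A Taylor polynomial estimate for a sequence of successive derivatives with `‖g n‖ ≤ B ^ n`. -/
lemma norm_sub_taylor_le {g : ℕ → ℝ → ℂ} {B : ℝ}
    (hg : ∀ n s, HasDerivAt (g n) (g (n + 1) s) s) (hB : ∀ n s, ‖g n s‖ ≤ B ^ n)
    (N n : ℕ) {s : ℝ} (hs : 0 ≤ s) :
    ‖g n s - ∑ k ∈ Finset.range N, g (n + k) 0 * (s : ℂ) ^ k / (k.factorial : ℂ)‖ ≤
      B ^ (n + N) * s ^ N / N.factorial := by
  induction N generalizing n s with
  | zero => simpa using hB n s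
  | succ N ih =>
    have hterm : ∀ (k : ℕ) (x : ℝ), HasDerivAt
        (fun x : ℝ => g (n + (k + 1)) 0 * (x : ℂ) ^ (k + 1) / ((k + 1).factorial : ℂ))
        (g (n + 1 + k) 0 * (x : ℂ) ^ k / (k.factorial : ℂ)) x := by
      intro k x
      have h1 := ((((hasDerivAt_pow (k + 1) (x : ℂ)).comp_ofReal).const_mul
        (g (n + (k + 1)) 0)).div_const ((k + 1).factorial : ℂ))
      convert! h1 using 1
      have : n + 1 + k = n + (k + 1) := by ring
      rw [this, Nat.factorial_succ]
      have h2 : (k.factorial : ℂ) ≠ 0 := by exact_mod_cast k.factorial_ne_zero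
      have h3 : ((k : ℂ) + 1) ≠ 0 := by exact_mod_cast k.succ_ne_zero
      push_cast
      field_simp
    have hder : ∀ x : ℝ, HasDerivAt
        (fun x : ℝ => g n x - ∑ k ∈ Finset.range (N + 1),
          g (n + k) 0 * (x : ℂ) ^ k / (k.factorial : ℂ))
        (g (n + 1) x - ∑ k ∈ Finset.range N,
          g (n + 1 + k) 0 * (x : ℂ) ^ k / (k.factorial : ℂ)) x := by
      intro x
      simp only [Finset.sum_range_succ' _ N]
      refine (hg n x).sub ?_
      simpa using (HasDerivAt.fun_sum (fun k _ => hterm k x)).add_const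
        (g (n + 0) 0 * ((0 : ℝ) : ℂ) ^ 0 / ((Nat.factorial 0 : ℕ) : ℂ))
    have hbd : ∀ x : ℝ, HasDerivAt (fun x : ℝ => B ^ (n + (N + 1)) * x ^ (N + 1) /
        (N + 1).factorial) (B ^ (n + 1 + N) * x ^ N / N.factorial) x := by
      intro x
      convert! ((hasDerivAt_pow (N + 1) x).const_mul (B ^ (n + (N + 1)))).div_const
        ((N + 1).factorial : ℝ) using 1
      have : n + 1 + N = n + (N + 1) := by ring
      rw [this, Nat.factorial_succ]
      have h2 : (N.factorial : ℝ) ≠ 0 := by exact_mod_cast N.factorial_ne_zero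
      push_cast
      field_simp
    refine image_norm_le_of_norm_deriv_right_le_deriv_boundary (a := 0) (b := s)
      (fun x _ => (hder x).continuousAt.continuousWithinAt)
      (fun x _ => (hder x).hasDerivWithinAt) ?_ hbd (fun x hx => ih (n + 1) hx.1)
      ⟨hs, le_rfl⟩
    simp [Finset.sum_range_succ']

/-- **Extension to an entire function.** A function on the line whose `n`-th derivative is bounded
by `B ^ n` agrees on the half-line `s ≥ 0` with an entire function of exponential type, the sum of
its Taylor series at `0`. -/
lemma exists_entire_extension {g : ℕ → ℝ → ℂ} {B : ℝ}
    (hg : ∀ n s, HasDerivAt (g n) (g (n + 1) s) s) (hB : ∀ n s, ‖g n s‖ ≤ B ^ n) :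
    ∃ F : ℂ → ℂ, Differentiable ℂ F ∧ (∀ z, ‖F z‖ ≤ Real.exp (B * ‖z‖)) ∧
      ∀ s : ℝ, 0 ≤ s → F s = g 0 s := by
  have hB0 : 0 ≤ B := by simpa using (norm_nonneg _).trans (hB 1 0)
  have hterm : ∀ (n : ℕ) (z : ℂ), ‖g n 0 * z ^ n / (n.factorial : ℂ)‖ ≤
      (B * ‖z‖) ^ n / n.factorial := by
    intro n z
    rw [norm_div, norm_mul, norm_pow, mul_pow, Complex.norm_natCast]
    gcongr
    exact hB n 0
  have hexp : ∀ r : ℝ, HasSum (fun n : ℕ => r ^ n / n.factorial) (Real.exp r) := fun r => by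
    have := NormedSpace.expSeries_div_hasSum_exp r
    rwa [← Real.exp_eq_exp_ℝ] at this
  have hsum : ∀ z : ℂ, Summable fun n : ℕ => g n 0 * z ^ n / (n.factorial : ℂ) := fun z =>
    Summable.of_norm_bounded (hexp (B * ‖z‖)).summable (fun n => hterm n z)
  refine ⟨fun z => ∑' n : ℕ, g n 0 * z ^ n / (n.factorial : ℂ), ?_, ?_, ?_⟩
  · intro z
    refine (Complex.differentiableOn_tsum_of_summable_norm (U := Metric.ball 0 (‖z‖ + 1))
      (hexp (B * (‖z‖ + 1))).summable (fun n => by fun_prop) Metric.isOpen_ball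
      (fun n w hw => (hterm n w).trans ?_)).differentiableAt
      (Metric.isOpen_ball.mem_nhds (by simp))
    have : ‖w‖ ≤ ‖z‖ + 1 := by simpa using (mem_ball_zero_iff.mp hw).le
    gcongr
  · intro z
    exact tsum_of_norm_bounded (hexp (B * ‖z‖)) (fun n => hterm n z)
  · intro s hs
    refine tendsto_nhds_unique (hsum s).hasSum.tendsto_sum_nat ?_
    have h0 : Tendsto (fun N : ℕ => (B * s) ^ N / N.factorial) atTop (𝓝 0) :=
      FloorSemiring.tendsto_pow_div_factorial_atTop (B * s)
    rw [tendsto_iff_norm_sub_tendsto_zero]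
    refine squeeze_zero (fun _ => norm_nonneg _) (fun N => ?_) h0
    have := norm_sub_taylor_le hg hB N 0 hs
    rw [norm_sub_rev]
    simpa [mul_pow] using this

/-- An entire function of at most linear growth is affine. -/
lemma eq_affine_of_linear_growth {g : ℂ → ℂ} (hg : Differentiable ℂ g) {C D : ℝ}
    (hbd : ∀ z, ‖g z‖ ≤ C + D * ‖z‖) : ∃ a b : ℂ, ∀ z, g z = a + b * z := by
  have hD : Differentiable ℂ (deriv g) := hg.contDiff (n := 2) |>.differentiable_deriv_two
  have h2 : ∀ c, deriv (deriv g) c = 0 := by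
    intro c
    have hest : ∀ R : ℝ, 0 < R → ‖deriv (deriv g) c‖ ≤
        2 * (C + |D| * ‖c‖) / R ^ 2 + 2 * |D| / R := by
      intro R hR
      have := Complex.norm_iteratedDeriv_le_of_forall_mem_sphere_norm_le 2 hR
        (hg.diffContOnCl (s := Metric.ball c R)) (C := C + |D| * (‖c‖ + R)) (fun z hz => by
          have hz' : ‖z‖ ≤ ‖c‖ + R := by
            have h := norm_add_le c (z - c)
            rwa [add_sub_cancel, mem_sphere_iff_norm.mp hz] at h
          refine (hbd z).trans ?_
          have : D * ‖z‖ ≤ |D| * (‖c‖ + R) :=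
            (mul_le_mul_of_nonneg_right (le_abs_self D) (norm_nonneg z)).trans (by gcongr)
          linarith)
      rw [iteratedDeriv_succ, iteratedDeriv_one] at this
      refine this.trans (le_of_eq ?_)
      simp only [Nat.factorial]
      push_cast
      field_simp
      ring
    have hlim : Tendsto (fun R : ℝ => 2 * (C + |D| * ‖c‖) / R ^ 2 + 2 * |D| / R) atTop
        (𝓝 (0 + 0)) :=
      (Tendsto.div_atTop tendsto_const_nhds (tendsto_pow_atTop two_ne_zero)).add
        (Tendsto.div_atTop tendsto_const_nhds tendsto_id)
    rw [add_zero] at hlim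
    exact norm_le_zero_iff.mp (ge_of_tendsto hlim ((eventually_gt_atTop 0).mono hest))
  have hconst : ∀ z, deriv g z = deriv g 0 := fun z => is_const_of_deriv_eq_zero hD h2 z 0
  refine ⟨g 0, deriv g 0, fun z => ?_⟩
  have hd : ∀ z, HasDerivAt (fun z => g z - deriv g 0 * z) (deriv g z - deriv g 0 * 1) z :=
    fun z => (hg z).hasDerivAt.sub ((hasDerivAt_id z).const_mul _)
  have := is_const_of_deriv_eq_zero (fun z => (hd z).differentiableAt)
    (fun z => by rw [(hd z).deriv, hconst z]; ring) z 0
  simp only [mul_zero, sub_zero] at this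
  rw [← this]; ring

/-- A zero-free entire function of exponential type is the exponential of an affine function: its
logarithm `g` has `Re g ≤ B ‖z‖`, so `g` grows at most linearly by the Borel–Carathéodory theorem. -/
lemma exists_eq_exp_affine {F : ℂ → ℂ} (hF : Differentiable ℂ F) (h0 : ∀ z, F z ≠ 0) {B : ℝ}
    (hB : 0 ≤ B) (hbd : ∀ z, ‖F z‖ ≤ Real.exp (B * ‖z‖)) :
    ∃ a b : ℂ, ∀ z, F z = Complex.exp (a + b * z) := by
  have hq : Differentiable ℂ (fun z => deriv F z / F z) :=
    (hF.contDiff (n := 2) |>.differentiable_deriv_two).div hF h0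
  obtain ⟨g, hg0, hg⟩ := hq.isExactOn_univ.with_val_at 0 (Complex.log (F 0))
  have hgd : Differentiable ℂ g := fun z => (hg z trivial).differentiableAt
  have hFg : ∀ z, F z = Complex.exp (g z) := by
    have hd : ∀ z, HasDerivAt (fun z => F z * Complex.exp (-g z)) 0 z := by
      intro z
      convert! (hF z).hasDerivAt.mul (hg z trivial).neg.cexp using 1
      field_simp [h0 z]
      ring
    intro z
    have := is_const_of_deriv_eq_zero (fun z => (hd z).differentiableAt)
      (fun z => (hd z).deriv) z 0
    simp only [hg0, Complex.exp_neg, Complex.exp_log (h0 0), mul_inv_cancel₀ (h0 0)] at this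
    field_simp [Complex.exp_ne_zero] at this
    exact this
  have hre : ∀ z, (g z).re ≤ B * ‖z‖ := by
    intro z
    have := hbd z
    rw [hFg z, Complex.norm_exp] at this
    exact Real.exp_le_exp.mp this
  have hlin : ∀ z, ‖g z‖ ≤ (2 + 3 * ‖g 0‖) + 4 * B * ‖z‖ := by
    intro z
    rcases eq_or_ne z 0 with rfl | hz
    · simp only [norm_zero, mul_zero, add_zero]; linarith [norm_nonneg (g 0)]
    have hz' : 0 < ‖z‖ := norm_pos_iff.mpr hz
    -- The radius `2‖z‖` makes every term of the estimate at most linear in `‖z‖`.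
    have := Complex.borelCaratheodory (f := g) (M := B * (2 * ‖z‖) + 1) (R := 2 * ‖z‖) (z := z)
      (by positivity) hgd.differentiableOn (fun w hw => by
        have hw' : ‖w‖ ≤ 2 * ‖z‖ := (mem_ball_zero_iff.mp hw).le
        have h1 := hre w
        have h2 : B * ‖w‖ ≤ B * (2 * ‖z‖) := by gcongr
        change (g w).re ≤ _
        linarith) (by positivity) (by rw [mem_ball_zero_iff]; linarith)
    refine this.trans (le_of_eq ?_)
    have e : 2 * ‖z‖ - ‖z‖ = ‖z‖ := by ring
    rw [e]
    field_simp
    ring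
  obtain ⟨a, b, hab⟩ := eq_affine_of_linear_growth hgd hlin
  exact ⟨a, b, fun z => by rw [hFg, hab]⟩

/-- If `|F| = 1` on a half-line, then `F(z) * conj F(conj z) = 1` there and hence everywhere, so
`F` has no zeros. -/
lemma ne_zero_of_norm_eq_one {F : ℂ → ℂ} (hF : Differentiable ℂ F)
    (h1 : ∀ s : ℝ, 0 ≤ s → ‖F s‖ = 1) (z : ℂ) : F z ≠ 0 := by
  have hG : Differentiable ℂ (fun z => F z * conj (F (conj z))) := by
    refine hF.mul fun z => ?_
    have h := (hF (conj z)).conj_conj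
    rwa [Complex.conj_conj] at h
  have hev : (fun z => F z * conj (F (conj z))) = fun _ => (1 : ℂ) := by
    refine AnalyticOnNhd.eq_of_frequently_eq (z₀ := 0)
      (fun z _ => hG.analyticAt z) (fun z _ => analyticAt_const) ?_
    have ht : Tendsto (fun n : ℕ => (((1 / ((n : ℝ) + 1) : ℝ)) : ℂ)) atTop (𝓝[≠] 0) := by
      refine tendsto_nhdsWithin_iff.mpr ⟨?_, Eventually.of_forall fun n => ?_⟩
      · have := (Complex.continuous_ofReal.tendsto 0).comp
          (tendsto_one_div_add_atTop_nhds_zero_nat (𝕜 := ℝ))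
        simpa [Function.comp_def] using this
      · have : (1 / ((n : ℝ) + 1) : ℝ) ≠ 0 := by positivity
        exact Complex.ofReal_ne_zero.mpr this
    refine ht.frequently (Frequently.of_forall fun n => ?_)
    rw [Complex.conj_ofReal, Complex.mul_conj, Complex.normSq_eq_norm_sq, h1 _ (by positivity)]
    simp
  intro hz
  have := congrFun hev z
  simp [hz] at this

/-- A function on the line of modulus one whose `n`-th derivative is bounded by `B ^ n` is the
exponential of an affine function on the half-line `s ≥ 0`. -/
lemma eq_exp_affine_of_deriv_bound {g : ℕ → ℝ → ℂ} {B : ℝ}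
    (hg : ∀ n s, HasDerivAt (g n) (g (n + 1) s) s) (hB : ∀ n s, ‖g n s‖ ≤ B ^ n)
    (h1 : ∀ s, ‖g 0 s‖ = 1) :
    ∃ a b : ℂ, ∀ s : ℝ, 0 ≤ s → g 0 s = Complex.exp (a + b * s) := by
  obtain ⟨F, hF, hFb, hFg⟩ := exists_entire_extension hg hB
  have hB0 : 0 ≤ B := by simpa using (norm_nonneg _).trans (hB 1 0)
  obtain ⟨a, b, hab⟩ := exists_eq_exp_affine hF
    (ne_zero_of_norm_eq_one hF fun s hs => by rw [hFg s hs, h1]) hB0 hFb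
  exact ⟨a, b, fun s hs => by rw [← hFg s hs, hab]⟩

/-! ### From phases to real affine functions -/

/-- A continuous real function whose phase `exp(-i t θ)` is the exponential of an affine function on
a half-line is affine there: the difference of the exponents is a continuous function with values in
`2πiℤ`. -/
lemma eq_affine_of_phase {θ : ℝ → ℝ} (hθ : Continuous θ) {t : ℝ} (ht : t ≠ 0) {a b : ℂ}
    (h : ∀ s : ℝ, 0 ≤ s → Complex.exp (-Complex.I * t * θ s) = Complex.exp (a + b * s)) :
    ∀ s : ℝ, 0 ≤ s → θ s = θ 0 + s * (θ 1 - θ 0) := by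
  set q : ℝ → ℝ := fun s => ((-Complex.I * t * θ s - (a + b * s)) / (2 * π * Complex.I)).re
    with hq
  have hqc : Continuous q := by
    refine Complex.continuous_re.comp ?_
    fun_prop
  have hint : ∀ s : ℝ, 0 ≤ s →
      ∃ n : ℤ, -Complex.I * t * θ s = a + b * s + n * (2 * π * Complex.I) :=
    fun s hs => Complex.exp_eq_exp_iff_exists_int.mp (h s hs)
  have hpi : (2 * π * Complex.I : ℂ) ≠ 0 := Complex.two_pi_I_ne_zero
  have hqi : ∀ (s : ℝ) (n : ℤ), -Complex.I * t * θ s = a + b * s + n * (2 * π * Complex.I) →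
      q s = n := by
    intro s n hn
    simp only [hq]
    rw [hn, add_sub_cancel_left, mul_div_cancel_right₀ _ hpi]
    simp
  obtain ⟨n0, hn0⟩ := hint 0 le_rfl
  have hconst : ∀ s : ℝ, 0 ≤ s → -Complex.I * t * θ s = a + b * s + n0 * (2 * π * Complex.I) := by
    intro s hs
    obtain ⟨n, hn⟩ := hint s hs
    suffices n = n0 by rw [hn, this]
    have hmaps : Set.MapsTo q (Set.Ici 0) (Set.range ((↑) : ℤ → ℝ)) := fun x hx => by
      obtain ⟨m, hm⟩ := hint x hx
      exact ⟨m, (hqi x m hm).symm⟩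
    have := isPreconnected_Ici.constant_of_mapsTo
      Int.isClosedEmbedding_coe_real.isEmbedding.isDiscrete_range hqc.continuousOn hmaps (x := s) (y := 0) hs Set.self_mem_Ici
    rw [hqi s n hn, hqi 0 n0 hn0] at this
    exact_mod_cast this
  intro s hs
  have e0 := hconst 0 le_rfl
  have e1 := hconst 1 zero_le_one
  have es := hconst s hs
  have key : (-Complex.I * t) * ((θ s : ℂ) - (θ 0 + s * (θ 1 - θ 0))) = 0 := by
    push_cast at e0 e1 es
    linear_combination es - e0 - s * (e1 - e0)
  have hne : (-Complex.I * t : ℂ) ≠ 0 := by simp [ht]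
  have := (mul_eq_zero.mp key).resolve_left hne
  have h2 : (θ s : ℂ) = ((θ 0 + s * (θ 1 - θ 0) : ℝ) : ℂ) := by
    push_cast; linear_combination this
  exact_mod_cast h2

/-- A real function on `ℝ^d` that is affine along every ray is affine. -/
lemma eq_affine_of_rays {d : ℕ} {w : EuclideanSpace ℝ (Fin d) → ℝ}
    (h : ∀ ξ v, ∀ s : ℝ, 0 ≤ s → w (ξ + s • v) = w ξ + s * (w (ξ + v) - w ξ)) :
    ∃ (a₀ : ℝ) (a : Fin d → ℝ), ∀ ξ, w ξ = a₀ + ∑ j, a j * ξ j := by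
  have hmid : ∀ x y, 2 * w ((2⁻¹ : ℝ) • (x + y)) = w x + w y := by
    intro x y
    have := h x (y - x) 2⁻¹ (by norm_num)
    rw [add_sub_cancel, show x + (2⁻¹ : ℝ) • (y - x) = (2⁻¹ : ℝ) • (x + y) by module] at this
    rw [this]; ring
  have hpos : ∀ (s : ℝ) x, 0 ≤ s → w (s • x) - w 0 = s * (w x - w 0) := by
    intro s x hs
    have := h 0 x s hs
    rw [zero_add, zero_add] at this
    rw [this]; ring
  have hadd : ∀ x y, w (x + y) - w 0 = (w x - w 0) + (w y - w 0) := by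
    intro x y
    have h1 := hmid x y
    have h2 := hpos 2⁻¹ (x + y) (by norm_num)
    linarith
  have hneg : ∀ x, w (-x) - w 0 = -(w x - w 0) := by
    intro x
    have := hadd x (-x)
    rw [add_neg_cancel] at this
    linarith
  let L : EuclideanSpace ℝ (Fin d) →ₗ[ℝ] ℝ :=
    { toFun := fun x => w x - w 0
      map_add' := hadd
      map_smul' := fun s x => by
        rcases le_total 0 s with hs | hs
        · exact hpos s x hs
        · have h1 := hpos (-s) x (neg_nonneg.mpr hs)
          have h2 := hneg (s • x)
          rw [← neg_smul] at h2
          simp only [RingHom.id_apply, smul_eq_mul]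
          linarith }
  refine ⟨w 0, fun j => L (EuclideanSpace.single j 1), fun ξ => ?_⟩
  have hξ : ξ = ∑ j, ξ j • EuclideanSpace.single j (1 : ℝ) := by
    ext i
    simp [Pi.single_apply]
  have : L ξ = ∑ j, L (EuclideanSpace.single j 1) * ξ j := by
    conv_lhs => rw [hξ]
    simp only [map_sum, map_smul, smul_eq_mul, mul_comm]
  rw [← this]
  change w ξ = w 0 + (w ξ - w 0)
  ring

open LineDeriv

/-! ### Bernstein's inequality for functions reproduced by a Schwartz kernel -/

section Bernstein

variable {E : Type*} [NormedAddCommGroup E] [InnerProductSpace ℝ E] [FiniteDimensional ℝ E]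
  [MeasurableSpace E] [BorelSpace E]

/-- A continuous function `g` with `‖g‖ ≤ M` that is reproduced by correlation with the Schwartz
function `φ`, that is, `g(ξ) = ∫ g(ξ + η) φ(η) dη`. -/
structure IsReproduced (φ : 𝓢(E, ℂ)) (M : ℝ) (g : E → ℂ) : Prop where
  continuous : Continuous g
  norm_le : ∀ ξ, ‖g ξ‖ ≤ M
  eq_integral : ∀ ξ, g ξ = ∫ η, g (ξ + η) * φ η

/-- Translates of a Schwartz function by vectors of bounded length have a common integrable
majorant. -/
lemma exists_integrable_bound_translate (ψ : 𝓢(E, ℂ)) (v : E) :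
    ∃ bound : E → ℝ, Integrable bound ∧ ∀ η, ∀ s : ℝ, |s| < 1 → ‖ψ (η - s • v)‖ ≤ bound η := by
  set k := Module.finrank ℝ E + 1 with hk
  obtain ⟨C, hC⟩ : ∃ C, ∀ x, (1 + ‖x‖) ^ k * ‖ψ x‖ ≤ C :=
    ⟨_, fun x => by
      simpa using SchwartzMap.one_add_le_sup_seminorm_apply (𝕜 := ℝ) (m := (k, 0)) (k := k) (n := 0)
        le_rfl le_rfl ψ x⟩
  refine ⟨fun η => (1 + ‖v‖) ^ k * C * (1 + ‖η‖) ^ (-(k : ℝ)), ?_, ?_⟩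
  · exact (integrable_one_add_norm (by rw [hk]; push_cast; linarith)).const_mul _
  · intro η s hs
    have h1 : ‖s • v‖ ≤ ‖v‖ := by
      rw [norm_smul, Real.norm_eq_abs]
      exact mul_le_of_le_one_left (norm_nonneg v) hs.le
    have h2 : 1 + ‖η‖ ≤ (1 + ‖v‖) * (1 + ‖η - s • v‖) := by
      have := norm_add_le (η - s • v) (s • v)
      rw [sub_add_cancel] at this
      nlinarith [norm_nonneg v, norm_nonneg (η - s • v)]
    beta_reduce
    rw [Real.rpow_neg (by positivity), Real.rpow_natCast, ← div_eq_mul_inv,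
      le_div_iff₀ (by positivity)]
    calc ‖ψ (η - s • v)‖ * (1 + ‖η‖) ^ k
        ≤ ‖ψ (η - s • v)‖ * ((1 + ‖v‖) * (1 + ‖η - s • v‖)) ^ k := by gcongr
      _ = (1 + ‖v‖) ^ k * ((1 + ‖η - s • v‖) ^ k * ‖ψ (η - s • v)‖) := by rw [mul_pow]; ring
      _ ≤ (1 + ‖v‖) ^ k * C := by gcongr; exact hC _

lemma integrable_mul_schwartz {g : E → ℂ} (hg : Continuous g) {M : ℝ} (hM : ∀ ξ, ‖g ξ‖ ≤ M)
    (ψ : 𝓢(E, ℂ)) (ξ : E) : Integrable fun η => g (ξ + η) * ψ η :=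
  ψ.integrable.bdd_mul (by fun_prop) (Eventually.of_forall fun η => hM (ξ + η))

/-- The correlation of a bounded continuous function with a Schwartz function is differentiable; the
derivative falls on the Schwartz function. -/
lemma hasDerivAt_correlation {g : E → ℂ} (hg : Continuous g) {M : ℝ} (hM : ∀ ξ, ‖g ξ‖ ≤ M)
    (φ : 𝓢(E, ℂ)) (v ξ : E) :
    HasDerivAt (fun s : ℝ => ∫ η, g (ξ + s • v + η) * φ η)
      (-∫ η, g (ξ + η) * (∂_{v} φ) η) 0 := by
  obtain ⟨bound, hbi, hb⟩ := exists_integrable_bound_translate (∂_{v} φ) v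
  have hshift : ∀ s : ℝ, ∫ η, g (ξ + s • v + η) * φ η = ∫ η, g (ξ + η) * φ (η - s • v) := by
    intro s
    rw [← integral_sub_right_eq_self _ (s • v)]
    congr 1 with η
    congr 2
    abel
  simp_rw [hshift]
  have hder := (hasDerivAt_integral_of_dominated_loc_of_deriv_le (μ := volume) (x₀ := (0 : ℝ))
    (F := fun s η => g (ξ + η) * φ (η - s • v))
    (F' := fun s η => g (ξ + η) * -(∂_{v} φ) (η - s • v)) (bound := fun η => M * bound η)
    (s := Metric.ball 0 1) (Metric.ball_mem_nhds 0 one_pos) ?_ ?_ ?_ ?_ ?_ ?_).2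
  · simpa [integral_neg] using hder
  · refine Eventually.of_forall fun s => Continuous.aestronglyMeasurable ?_
    have := φ.continuous
    fun_prop
  · simpa using integrable_mul_schwartz hg hM φ ξ
  · refine Continuous.aestronglyMeasurable ?_
    have := (∂_{v} φ).continuous
    fun_prop
  · refine Eventually.of_forall fun η s hs => ?_
    rw [norm_mul, norm_neg]
    have hM0 : 0 ≤ M := (norm_nonneg _).trans (hM ξ)
    gcongr
    · exact hM _
    · exact hb η s (by simpa using hs)
  · exact hbi.const_mul M
  · refine Eventually.of_forall fun η s _ => HasDerivAt.const_mul _ ?_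
    have h1 : HasDerivAt (fun s : ℝ => η - s • v) (-v) s := by
      simpa using ((hasDerivAt_id s).smul_const v).const_sub η
    have h2 := (φ.differentiableAt (x := η - s • v)).hasFDerivAt.comp_hasDerivAt s h1
    rw [map_neg] at h2
    rw [SchwartzMap.lineDerivOp_apply_eq_fderiv]
    exact h2

/-- The function `ξ ↦ -∫ g(ξ + η) ∂ᵥφ(η) dη`, which is the derivative of `g` in the direction `v` if
`g` is reproduced by `φ`. -/
noncomputable def kernelDeriv (φ : 𝓢(E, ℂ)) (v : E) (g : E → ℂ) (ξ : E) : ℂ :=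
  -∫ η, g (ξ + η) * (∂_{v} φ) η

variable {φ : 𝓢(E, ℂ)} {M : ℝ} {g : E → ℂ}

lemma IsReproduced.hasDerivAt (h : IsReproduced φ M g) (v ξ : E) (s : ℝ) :
    HasDerivAt (fun s : ℝ => g (ξ + s • v)) (kernelDeriv φ v g (ξ + s • v)) s := by
  have h1 := hasDerivAt_correlation h.continuous h.norm_le φ v (ξ + s • v)
  have h2 : (fun t : ℝ => ∫ η, g (ξ + s • v + t • v + η) * φ η) =
      fun t => g (ξ + (s + t) • v) := by
    ext t
    rw [← h.eq_integral]
    congr 1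
    module
  rw [h2] at h1
  have h3 : HasDerivAt (fun t : ℝ => t - s) 1 s := (hasDerivAt_id s).sub_const s
  have h4 := HasDerivAt.scomp (h := fun t : ℝ => t - s) s (by simpa using h1) h3
  simpa [Function.comp_def, kernelDeriv] using h4

/-- **Bernstein's inequality.** The derivative of a reproduced function is reproduced by the same
kernel, and its sup norm grows by a factor that depends on the kernel only. -/
lemma IsReproduced.kernelDeriv (h : IsReproduced φ M g) (v : E) :
    IsReproduced φ (M * ∫ η, ‖(∂_{v} φ) η‖) (kernelDeriv φ v g) := by
  have hM0 : 0 ≤ M := (norm_nonneg _).trans (h.norm_le 0)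
  have hcont : Continuous (DispersiveSupport.kernelDeriv φ v g) := by
    refine (continuous_of_dominated (bound := fun η => M * ‖(∂_{v} φ) η‖) (fun ξ => ?_)
      (fun ξ => Eventually.of_forall fun η => ?_) ((∂_{v} φ).integrable.norm.const_mul M)
      (Eventually.of_forall fun η => ?_)).neg
    · exact (integrable_mul_schwartz h.continuous h.norm_le _ ξ).aestronglyMeasurable
    · rw [norm_mul]; gcongr; exact h.norm_le _
    · have := h.continuous
      fun_prop
  have hbd : ∀ ξ, ‖DispersiveSupport.kernelDeriv φ v g ξ‖ ≤ M * ∫ η, ‖(∂_{v} φ) η‖ := by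
    intro ξ
    rw [DispersiveSupport.kernelDeriv, norm_neg, ← integral_const_mul]
    refine norm_integral_le_of_norm_le ((∂_{v} φ).integrable.norm.const_mul M)
      (Eventually.of_forall fun η => ?_)
    rw [norm_mul]; gcongr; exact h.norm_le _
  refine ⟨hcont, hbd, fun ξ => ?_⟩
  -- Both sides are the derivative at `s = 0` of `g (ξ + s • v) = ∫ g (ξ + s • v + η) φ(η) dη`.
  have h1 : HasDerivAt (fun s : ℝ => g (ξ + s • v)) (DispersiveSupport.kernelDeriv φ v g ξ) 0 := by
    simpa using h.hasDerivAt v ξ 0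
  have h2 := (hasDerivAt_integral_of_dominated_loc_of_deriv_le (μ := volume) (x₀ := (0 : ℝ))
    (F := fun s η => g (ξ + s • v + η) * φ η)
    (F' := fun s η => DispersiveSupport.kernelDeriv φ v g (ξ + s • v + η) * φ η)
    (bound := fun η => (M * ∫ η, ‖(∂_{v} φ) η‖) * ‖φ η‖) (s := Set.univ) univ_mem
    (Eventually.of_forall fun s =>
      (integrable_mul_schwartz h.continuous h.norm_le φ _).aestronglyMeasurable)
    (integrable_mul_schwartz h.continuous h.norm_le φ _)
    (integrable_mul_schwartz hcont hbd φ _).aestronglyMeasurable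
    (Eventually.of_forall fun η s _ => by rw [norm_mul]; gcongr; exact hbd _)
    (φ.integrable.norm.const_mul _)
    (Eventually.of_forall fun η s _ => by
      have := h.hasDerivAt v (ξ + η) s
      simp only [add_right_comm ξ η] at this
      exact this.mul_const _)).2
  simp only [← h.eq_integral, zero_smul, add_zero] at h2
  exact h1.unique h2

/-- On every ray, a unimodular reproduced function is the exponential of an affine function. -/
lemma IsReproduced.eq_exp_affine (h : IsReproduced φ 1 g) (hg : ∀ ξ, ‖g ξ‖ = 1) (ξ v : E) :
    ∃ a b : ℂ, ∀ s : ℝ, 0 ≤ s → g (ξ + s • v) = Complex.exp (a + b * s) := by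
  set B := ∫ η, ‖(∂_{v} φ) η‖
  have hrep : ∀ n : ℕ, IsReproduced φ (B ^ n) ((DispersiveSupport.kernelDeriv φ v)^[n] g) := by
    intro n
    induction n with
    | zero => simpa using h
    | succ n ih =>
      rw [Function.iterate_succ_apply', pow_succ]
      exact ih.kernelDeriv v
  exact eq_exp_affine_of_deriv_bound
    (g := fun n s => (DispersiveSupport.kernelDeriv φ v)^[n] g (ξ + s • v))
    (fun n s => by
      simp only [Function.iterate_succ_apply']
      exact (hrep n).hasDerivAt v ξ s)
    (fun n s => (hrep n).norm_le _) (fun s => hg _)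

end Bernstein

open scoped ContDiff Manifold

/-! ### Test functions supported away from the distributional support -/

/-- A tempered distribution vanishes on compactly supported test functions whose support does not
meet the distributional support: a finite partition of unity reduces this to the definition. -/
lemma apply_eq_zero_of_disjoint_dsupport {E : Type*} [NormedAddCommGroup E] [NormedSpace ℝ E]
    [FiniteDimensional ℝ E] (K : 𝓢'(E, ℂ)) (f : 𝓢(E, ℂ)) (hf : HasCompactSupport f)
    (hd : Disjoint (tsupport f) (Distribution.dsupport K)) : K f = 0 := by
  have hloc : ∀ x ∈ tsupport f, ∃ s : Set E,
      Distribution.IsVanishingOn K s ∧ IsOpen s ∧ x ∈ s := fun x hx =>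
    (Distribution.notMem_dsupport_iff x).mp (Set.disjoint_left.mp hd hx)
  choose! U hU hUo hxU using hloc
  obtain ⟨t, hts, htU⟩ := hf.isCompact.elim_nhds_subcover U
    fun x hx => (hUo x hx).mem_nhds (hxU x hx)
  have hcover : tsupport f ⊆ ⋃ i : t, U i := fun x hx => by
    obtain ⟨i, hi, hxi⟩ := Set.mem_iUnion₂.mp (htU hx)
    exact Set.mem_iUnion.mpr ⟨⟨i, hi⟩, hxi⟩
  obtain ⟨ρ, hρ⟩ := SmoothPartitionOfUnity.exists_isSubordinate 𝓘(ℝ, E) (isClosed_tsupport f)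
    (fun i : t => U i) (fun i => hUo i (hts i i.2)) hcover
  have hcs : ∀ i : t, HasCompactSupport fun x => ρ i x • f x := fun i =>
    HasCompactSupport.smul_left (f := fun x => ρ i x) hf
  have hsm : ∀ i : t, ContDiff ℝ ∞ fun x => ρ i x • f x := fun i => by
    have h1 : ContDiff ℝ ∞ (fun x => ρ i x) := (ρ i).contMDiff.contDiff
    exact h1.smul (f.smooth ⊤)
  have hsum : f = ∑ i : t, (hcs i).toSchwartzMap (hsm i) := by
    ext x
    rw [sum_apply]
    change f x = ∑ i : t, ρ i x • f x
    rw [← Finset.sum_smul]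
    by_cases hx : x ∈ tsupport f
    · rw [← finsum_eq_sum_of_fintype, ρ.sum_eq_one hx, one_smul]
    · rw [image_eq_zero_of_notMem_tsupport hx, smul_zero]
  rw [hsum, map_sum]
  refine Finset.sum_eq_zero fun i _ => hU i (hts i i.2) _ ?_
  exact (tsupport_smul_subset_left (ρ i) f).trans (hρ i)

/-! ### The reproducing formula -/

section Reproducing

variable {d : ℕ}

/-- Fourier inversion for the normalisation of `schwartzFourierInv`. -/
lemma integral_exp_mul_schwartzFourierInv (f : 𝓢(EuclideanSpace ℝ (Fin d), ℂ))
    (a : EuclideanSpace ℝ (Fin d)) :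
    ∫ ξ, Complex.exp (-Complex.I * (inner ℝ a ξ : ℝ)) * schwartzFourierInv d f ξ = f a := by
  have hinv : (𝓕 (𝓕⁻ f) : 𝓢(EuclideanSpace ℝ (Fin d), ℂ)) a = f a := by
    rw [FourierTransform.fourier_fourierInv_eq]
  rw [SchwartzMap.fourier_coe, Real.fourier_eq'] at hinv
  rw [← hinv]
  have h : ∀ x, schwartzFourierInv d f x =
      (((2 * π) ^ d)⁻¹ : ℂ) * (𝓕⁻ f : 𝓢(EuclideanSpace ℝ (Fin d), ℂ)) ((2 * π)⁻¹ • x) :=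
    fun x => rfl
  have key := Measure.integral_comp_inv_smul_of_nonneg (volume : Measure (EuclideanSpace ℝ (Fin d)))
    (fun v => Complex.exp (↑(-2 * π * inner ℝ v a) * Complex.I) •
      (𝓕⁻ f : 𝓢(EuclideanSpace ℝ (Fin d), ℂ)) v) (R := 2 * π) (by positivity)
  rw [finrank_euclideanSpace_fin] at key
  rw [← inv_smul_eq_iff₀ (by positivity)] at key
  rw [← key, Complex.real_smul, ← integral_const_mul]
  congr 1 with ξ
  rw [h, smul_eq_mul, inner_smul_left, real_inner_comm]
  have he : -Complex.I * (inner ℝ ξ a : ℝ) =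
      ((-2 * π * ((starRingEnd ℝ) (2 * π)⁻¹ * inner ℝ ξ a) : ℝ) : ℂ) * Complex.I := by
    have : (π : ℂ) ≠ 0 := by exact_mod_cast Real.pi_ne_zero
    simp only [conj_trivial]
    push_cast
    field_simp
  rw [he]
  push_cast
  ring

/-- A fixed smooth cutoff, equal to `1` on the closed unit ball and supported in the closed ball of
radius `2`. -/
noncomputable def cutoff (d : ℕ) : ContDiffBump (0 : EuclideanSpace ℝ (Fin d)) :=
  ⟨1, 2, one_pos, one_lt_two⟩

lemma hasCompactSupport_cutoff_smul_mul {R : ℝ} (hR : 0 < R)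
    (g : EuclideanSpace ℝ (Fin d) → ℂ) :
    HasCompactSupport fun x => (cutoff d (R⁻¹ • x) : ℂ) * g x := by
  have h : HasCompactSupport fun x => (cutoff d (R⁻¹ • x) : ℂ) :=
    ((cutoff d).hasCompactSupport.comp_smul (inv_ne_zero hR.ne')).comp_left
      (g := fun r : ℝ => (r : ℂ)) Complex.ofReal_zero
  exact h.mul_right

/-- The truncated plane wave `x ↦ χ(x / R) exp(-i x·ξ)` with `χ` the cutoff, as a Schwartz function. -/
noncomputable def truncatedWave {R : ℝ} (hR : 0 < R) (ξ : EuclideanSpace ℝ (Fin d)) :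
    𝓢(EuclideanSpace ℝ (Fin d), ℂ) :=
  (hasCompactSupport_cutoff_smul_mul hR
    (fun x => Complex.exp (-Complex.I * (inner ℝ x ξ : ℝ)))).toSchwartzMap (by
      have h1 : ContDiff ℝ ∞ fun x : EuclideanSpace ℝ (Fin d) => cutoff d (R⁻¹ • x) :=
        (cutoff d).contDiff.comp (contDiff_const_smul _)
      have h2 : ContDiff ℝ ∞ fun x : EuclideanSpace ℝ (Fin d) => inner ℝ x ξ :=
        contDiff_id.inner ℝ contDiff_const
      have h3 := Complex.ofRealCLM.contDiff.comp h1
      have h4 := Complex.ofRealCLM.contDiff.comp h2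
      exact h3.mul (contDiff_const.mul h4).cexp)

lemma truncatedWave_apply {R : ℝ} (hR : 0 < R) (ξ x : EuclideanSpace ℝ (Fin d)) :
    truncatedWave hR ξ x =
      (cutoff d (R⁻¹ • x) : ℂ) * Complex.exp (-Complex.I * (inner ℝ x ξ : ℝ)) := rfl

/-- Modulation of a test function translates its inverse Fourier transform. -/
lemma schwartzFourierInv_truncatedWave {R : ℝ} (hR : 0 < R) (ξ η : EuclideanSpace ℝ (Fin d)) :
    schwartzFourierInv d (truncatedWave hR ξ) (ξ + η) =
      schwartzFourierInv d (truncatedWave hR 0) η := by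
  rw [schwartzFourierInv_apply, schwartzFourierInv_apply]
  congr 2 with x
  simp only [truncatedWave_apply, mul_assoc, ← Complex.exp_add]
  congr 2
  rw [inner_add_left, real_inner_comm ξ x, inner_zero_right]
  push_cast
  ring

/-- Dilation of the cutoff by `R` concentrates its inverse Fourier transform. -/
lemma schwartzFourierInv_truncatedWave_zero {R : ℝ} (hR : 0 < R) (η : EuclideanSpace ℝ (Fin d)) :
    schwartzFourierInv d (truncatedWave hR 0) η =
      (R ^ d : ℝ) • schwartzFourierInv d (truncatedWave one_pos 0) (R • η) := by
  rw [schwartzFourierInv_apply, schwartzFourierInv_apply]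
  have key := Measure.integral_comp_inv_smul_of_nonneg (volume : Measure (EuclideanSpace ℝ (Fin d)))
    (fun x => truncatedWave (d := d) one_pos 0 x *
      Complex.exp (Complex.I * (inner ℝ (R • η) x : ℝ))) hR.le
  rw [finrank_euclideanSpace_fin] at key
  rw [← mul_smul_comm, ← key]
  congr 2 with x
  simp only [truncatedWave_apply, inner_zero_right, inv_one, one_smul]
  rw [inner_smul_left, inner_smul_right, conj_trivial, mul_inv_cancel_left₀ hR.ne']

lemma norm_symbol (w : C(EuclideanSpace ℝ (Fin d), ℝ)) (t : ℝ) (ξ : EuclideanSpace ℝ (Fin d)) :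
    ‖symbol w t ξ‖ = 1 := by
  simp [symbol, Complex.norm_exp]

lemma continuous_symbol (w : C(EuclideanSpace ℝ (Fin d), ℝ)) (t : ℝ) : Continuous (symbol w t) := by
  unfold symbol
  fun_prop

lemma fundamentalSolution_truncatedWave (w : C(EuclideanSpace ℝ (Fin d), ℝ)) (t : ℝ) {R : ℝ}
    (hR : 0 < R) (ξ : EuclideanSpace ℝ (Fin d)) :
    fundamentalSolution w t (truncatedWave hR ξ) =
      ∫ η, symbol w t (ξ + η) * schwartzFourierInv d (truncatedWave hR 0) η := by
  rw [fundamentalSolution_apply, ← integral_add_left_eq_self _ ξ]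
  simp only [schwartzFourierInv_truncatedWave]
  rfl

/-- As the truncation is removed, the fundamental solution applied to a plane wave recovers the
symbol, because the inverse Fourier transforms of the dilated cutoffs are an approximate identity. -/
lemma tendsto_fundamentalSolution_truncatedWave (w : C(EuclideanSpace ℝ (Fin d), ℝ)) (t : ℝ)
    (ξ : EuclideanSpace ℝ (Fin d)) :
    Tendsto (fun n : ℕ => fundamentalSolution w t (truncatedWave n.cast_add_one_pos ξ)) atTop
      (𝓝 (symbol w t ξ)) := by
  set ψ := schwartzFourierInv d (truncatedWave one_pos 0) with hψ
  have h1 : ∀ n : ℕ, fundamentalSolution w t (truncatedWave n.cast_add_one_pos ξ) =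
      ∫ η, symbol w t (ξ + ((n : ℝ) + 1)⁻¹ • η) * ψ η := by
    intro n
    have hR : (0 : ℝ) < (n : ℝ) + 1 := n.cast_add_one_pos
    rw [fundamentalSolution_truncatedWave]
    have key := Measure.integral_comp_smul (volume : Measure (EuclideanSpace ℝ (Fin d)))
      (fun η => symbol w t (ξ + ((n : ℝ) + 1)⁻¹ • η) * ψ η) ((n : ℝ) + 1)
    rw [finrank_euclideanSpace_fin, abs_of_pos (by positivity), eq_inv_smul_iff₀ (by positivity),
      ← integral_smul] at key
    rw [← key]
    congr 1 with η
    rw [schwartzFourierInv_truncatedWave_zero, inv_smul_smul₀ hR.ne', mul_smul_comm]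
  simp_rw [h1]
  -- The kernel `ψ` has total mass `χ(0) = 1`.
  have h2 : ∫ η, symbol w t ξ * ψ η = symbol w t ξ := by
    have := integral_exp_mul_schwartzFourierInv (truncatedWave (d := d) one_pos 0) 0
    simp only [inner_zero_left, Complex.ofReal_zero, mul_zero, Complex.exp_zero, one_mul,
      truncatedWave_apply, mul_one, smul_zero] at this
    rw [(cutoff d).one_of_mem_closedBall (Metric.mem_closedBall_self (cutoff d).rIn_pos.le)] at this
    rw [integral_const_mul, this, Complex.ofReal_one, mul_one]
  rw [← h2]
  refine tendsto_integral_of_dominated_convergence (fun η => ‖ψ η‖) (fun n => ?_)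
    ψ.integrable.norm (fun n => Eventually.of_forall fun η => ?_)
    (Eventually.of_forall fun η => ?_)
  · refine Continuous.aestronglyMeasurable ?_
    have := ψ.continuous
    have := continuous_symbol w t
    fun_prop
  · rw [norm_mul, norm_symbol, one_mul]
  · refine Tendsto.mul_const _ ?_
    have hn : Tendsto (fun n : ℕ => ξ + ((n : ℝ) + 1)⁻¹ • η) atTop (𝓝 (ξ + (0 : ℝ) • η)) := by
      refine Tendsto.const_add _ (Tendsto.smul_const ?_ _)
      simpa using tendsto_one_div_add_atTop_nhds_zero_nat (𝕜 := ℝ)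
    rw [zero_smul, add_zero] at hn
    exact ((continuous_symbol w t).tendsto ξ).comp hn

/-- If the fundamental solution has compact support, two truncations beyond that support are
indistinguishable to it. -/
lemma fundamentalSolution_truncatedWave_eq (w : C(EuclideanSpace ℝ (Fin d), ℝ)) (t : ℝ) {r R R' : ℝ}
    (hS : Distribution.dsupport (fundamentalSolution w t) ⊆ Metric.ball 0 r)
    (hR : 0 < R) (hR' : 0 < R') (hrR : r ≤ R) (hrR' : r ≤ R') (ξ : EuclideanSpace ℝ (Fin d)) :
    fundamentalSolution w t (truncatedWave hR ξ) =
      fundamentalSolution w t (truncatedWave hR' ξ) := by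
  rw [← sub_eq_zero, ← map_sub]
  refine apply_eq_zero_of_disjoint_dsupport _ _ ?_ ?_
  · exact (hasCompactSupport_cutoff_smul_mul hR _).sub (hasCompactSupport_cutoff_smul_mul hR' _)
  · have hone : ∀ {Q : ℝ}, 0 < Q → r ≤ Q → ∀ x ∈ Metric.ball (0 : EuclideanSpace ℝ (Fin d)) r,
        cutoff d (Q⁻¹ • x) = 1 := by
      intro Q hQ hrQ x hx
      refine (cutoff d).one_of_mem_closedBall ?_
      rw [mem_closedBall_zero_iff, norm_smul, norm_inv, Real.norm_eq_abs, abs_of_pos hQ]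
      change Q⁻¹ * ‖x‖ ≤ 1
      rw [inv_mul_le_one₀ hQ]
      exact (mem_ball_zero_iff.mp hx).le.trans hrQ
    refine Set.disjoint_left.mpr fun x hx hxS => ?_
    refine notMem_tsupport_iff_eventuallyEq.mpr ?_ hx
    filter_upwards [Metric.isOpen_ball.mem_nhds (hS hxS)] with y hy
    rw [sub_apply, truncatedWave_apply, truncatedWave_apply, hone hR hrR y hy,
      hone hR' hrR' y hy, sub_self, Pi.zero_apply]

/-- **Reproducing formula.** If the fundamental solution has compact support, the symbol is
reproduced by a Schwartz kernel. -/
lemma exists_isReproduced_symbol (w : C(EuclideanSpace ℝ (Fin d), ℝ)) (t : ℝ)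
    (hK : IsCompact (Distribution.dsupport (fundamentalSolution w t))) :
    ∃ φ : 𝓢(EuclideanSpace ℝ (Fin d), ℂ), IsReproduced φ 1 (symbol w t) := by
  obtain ⟨r, hr⟩ := hK.isBounded.subset_ball 0
  obtain ⟨N, hN⟩ := exists_nat_ge r
  refine ⟨schwartzFourierInv d (truncatedWave N.cast_add_one_pos 0), continuous_symbol w t,
    fun ξ => (norm_symbol w t ξ).le, fun ξ => ?_⟩
  rw [← fundamentalSolution_truncatedWave]
  refine tendsto_nhds_unique (tendsto_fundamentalSolution_truncatedWave w t ξ)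
    (tendsto_const_nhds.congr' ?_)
  filter_upwards [eventually_ge_atTop N] with n hn
  have hn' : (N : ℝ) ≤ n := by exact_mod_cast hn
  exact fundamentalSolution_truncatedWave_eq w t hr _ _ (by linarith) (by linarith) ξ

end Reproducing

/-! ### Affine symbols -/

/-- For an affine symbol the fundamental solution is a multiple of a Dirac mass. -/
lemma dsupport_fundamentalSolution_subset {d : ℕ} {w : C(EuclideanSpace ℝ (Fin d), ℝ)} {a₀ : ℝ}
    {a : EuclideanSpace ℝ (Fin d)} (hw : ∀ ξ, w ξ = a₀ + inner ℝ a ξ) :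
    Distribution.dsupport (fundamentalSolution w 1) ⊆ {a} := by
  have hK : ∀ f, fundamentalSolution w 1 f = Complex.exp (-Complex.I * a₀) * f a := by
    intro f
    rw [fundamentalSolution_apply, ← integral_exp_mul_schwartzFourierInv f a, ← integral_const_mul]
    congr 1 with ξ
    rw [← mul_assoc, ← Complex.exp_add, hw]
    congr 2
    push_cast
    ring
  intro x hx
  refine (Distribution.mem_dsupport_iff x).mp hx {a} (fun f hf => ?_) isClosed_singleton
  rw [hK, image_eq_zero_of_notMem_tsupport (fun h => hf h rfl), mul_zero]

end DispersiveSupport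

theorem mainTheorem2 (d : ℕ) (w : C(EuclideanSpace ℝ (Fin d), ℝ)) :
    (∃ t : ℝ, t ≠ 0 ∧
        IsCompact (Distribution.dsupport (DispersiveSupport.fundamentalSolution w t))) ↔
      ∃ (a₀ : ℝ) (a : Fin d → ℝ),
        ∀ ξ : EuclideanSpace ℝ (Fin d), w ξ = a₀ + ∑ j, a j * ξ j := by
  constructor
  · rintro ⟨t, ht, hK⟩
    obtain ⟨φ, hφ⟩ := DispersiveSupport.exists_isReproduced_symbol w t hK
    refine DispersiveSupport.eq_affine_of_rays fun ξ v s hs => ?_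
    obtain ⟨a, b, hab⟩ := hφ.eq_exp_affine (DispersiveSupport.norm_symbol w t) ξ v
    have := DispersiveSupport.eq_affine_of_phase (θ := fun s => w (ξ + s • v)) (by fun_prop) ht
      hab s hs
    simpa using this
  · rintro ⟨a₀, a, hw⟩
    refine ⟨1, one_ne_zero, isCompact_singleton.of_isClosed_subset
      Distribution.isClosed_dsupport
      (DispersiveSupport.dsupport_fundamentalSolution_subset (a₀ := a₀) (a := WithLp.toLp 2 a)
        fun ξ => ?_)⟩
    rw [hw, PiLp.inner_apply]
    simp [mul_comm]
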